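/- Setting. Let $\Omega$ be a finite set of states and let $f_1,\dots,f_m\subseteq\Omega$ be flaws, ordered by priority according to a fixed permutation. Flaw $f_i$ is present in $\sigma$ if $\sigma\in f_i$; $\sigma$ is flawless if no flaw is present in it; $\pi(\sigma)$ denotes the highest-priority flaw present in a flawed state $\sigma$. A policy maps each lightbulb vector in $\{0,1\}^m$ to a probability distribution over actions, and taking action $a$ in state $\sigma$ leads to a random state whose distribution depends on $\sigma$ and $a$. Let $\rho_{\mathrm{pr}}(\sigma,\cdot)$ be the resulting transition distribution when the policy is applied to the true vector of flaws present in $\sigma$, if $\sigma$ is flawed, and the point mass at $\sigma$ if $\sigma$ is flawless; let $D_{\mathrm{pr}}$ be the digraph of transitions $(\sigma,\tau)$ with $\rho_{\mathrm{pr}}(\sigma,\tau)>0$. Let $D_{\mathrm{ns}}$ be an arbitrary digraph on $\Omega$ and, for each $\sigma$, let $\rho_{\mathrm{ns}}(\sigma,\cdot)$ be an arbitrary probability distribution on the arcs of $D_{\mathrm{ns}}$ leaving $\sigma$. For $p\in[0,1]$ consider the Markov chain on $\Omega$ with transition probabilities $\rho=(1-p)\rho_{\mathrm{pr}}+p\,\rho_{\mathrm{ns}}$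 and arbitrary initial distribution. Notation. For $\bullet\in\{\mathrm{pr},\mathrm{ns}\}$ let $\Gamma_\bullet(f_i)$ consist of $f_i$ and of every $f_j$ for which $D_\bullet$ has an arc $(\sigma,\tau)$ with $\pi(\sigma)=f_i$, $\sigma\notin f_j$, $\tau\in f_j$. Let $$b_\bullet^{f_i}=\log_2\max_{\tau\in\Omega}|\{\sigma\in f_i:\rho_\bullet(\sigma,\tau)>0\}|,\qquad b_{\mathrm{ns}}=\max_i b_{\mathrm{ns}}^{f_i},\qquad \Delta_i=|\Gamma_{\mathrm{ns}}(f_i)|,$$ $$h(p)=-p\log_2p-(1-p)\log_2(1-p),\qquad q_i(p)=p\left(\Delta_i\left(b_{\mathrm{ns}}+\tfrac52+h(p)\right)-2-h(p)\right),$$ $$\mathrm{Potential}(f_i)=\min_{\sigma:\pi(\sigma)=f_i}H[\rho(\sigma,\cdot)],\qquad \mathrm{Amenability}(f_i)=\mathrm{Potential}(f_i)-b_{\mathrm{pr}}^{f_i},$$ where $H$ is the base-2 entropy and $\min\emptyset=+\infty$ (with $2^{-\infty}=0$). Theorem. For every $\varepsilon>0$ there is a constant $R>0$, depending only on $\varepsilon$,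 such that the following holds for every system as above. If for every flaw $f_i$ $$\sum_{f_j\in\Gamma_{\mathrm{pr}}(f_i)}2^{-\mathrm{Amenability}(f_j)+q_j(p)}\le 2^{-(2+h(p))}-\varepsilon$$ (that is, the sum is less than $2^{-(2+h(p))}$ for every $i$, with slack at least $\varepsilon$), then for every $s>1/2$ the probability that the chain does not reach a flawless state within $R\,s\,(\log_2|\Omega|+m)$ steps is less than $\exp(-s)$. The noiseless case $p=0$ is included; there the left-hand side is $\sum_{f_j\in\Gamma_{\mathrm{pr}}(f_i)}2^{-\mathrm{Amenability}(f_j)}$ and the right-hand side is $\frac14-\varepsilon$. -/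

import Mathlib

universe u v

/-- A finite-state system with `m` flaws steered by a prioritizing controller in a noisy
environment. `Ω` is the state space and `A` the set of actions. -/
structure NoisyControl (m : ℕ) (Ω : Type u) (A : Type v) where
  /-- the flaws: `flaw i` is the set of states in which flaw `i` is present -/
  flaw : Fin m → Set Ω
  /-- the priority permutation; rank `0` is the highest priority -/
  rank : Equiv.Perm (Fin m)
  /-- the policy: each lightbulb vector is mapped to a distribution over actions -/
  policy : (Fin m → Bool) → PMF A
  /-- distribution of the new state when a given action is taken in a given state -/
  effect : Ω → A → PMF Ω
  /-- the arcs of the (arbitrary) noise digraph -/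
  noiseArc : Ω → Ω → Prop
  /-- the (arbitrary) noise transition probabilities -/
  noise : Ω → PMF Ω
  /-- the noise distribution at `σ` lives on the noise arcs leaving `σ` -/
  noise_on_arcs : ∀ σ, ∀ τ ∈ (noise σ).support, noiseArc σ τ
  /-- the intensity of the noise -/
  p : ℝ
  p_nonneg : 0 ≤ p
  p_le_one : p ≤ 1

namespace NoisyControl

/-- Base-2 binary entropy `h(x) = -x log₂ x - (1-x) log₂ (1-x)`. -/
noncomputable def binEntropyTwo (x : ℝ) : ℝ :=
  -(x * Real.logb 2 x) - (1 - x) * Real.logb 2 (1 - x)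

variable {m : ℕ} {Ω : Type u} {A : Type v}

/-- No flaw is present in `σ`. -/
def Flawless (S : NoisyControl m Ω A) (σ : Ω) : Prop :=
  ∀ i, σ ∉ S.flaw i

/-- Flaw `i` is the highest-priority flaw present in `σ` (the flaw addressed at `σ`). -/
def Addresses (S : NoisyControl m Ω A) (σ : Ω) (i : Fin m) : Prop :=
  σ ∈ S.flaw i ∧ ∀ j, σ ∈ S.flaw j → S.rank i ≤ S.rank j

open Classical in
/-- The true lightbulb vector of `σ`. -/
noncomputable def lights (S : NoisyControl m Ω A) (σ : Ω) : Fin m → Bool :=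
  fun i => decide (σ ∈ S.flaw i)

open Classical in
/-- The principal transition distribution: at a flawed state, an action is sampled from the policy
at the true lightbulb vector and the system reacts to it; flawless states carry self-loops. -/
noncomputable def principal (S : NoisyControl m Ω A) (σ : Ω) : PMF Ω :=
  if S.Flawless σ then PMF.pure σ else (S.policy (S.lights σ)).bind (S.effect σ)

/-- The arcs of the principal digraph: the possible principal transitions. -/
def principalArc (S : NoisyControl m Ω A) (σ τ : Ω) : Prop :=
  τ ∈ (S.principal σ).support

/-- The transition probabilities of the process: the mixture
`ρ = (1 - p) ρ_pr + p ρ_ns`. -/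
noncomputable def trans (S : NoisyControl m Ω A) (σ τ : Ω) : ℝ :=
  (1 - S.p) * (S.principal σ τ).toReal + S.p * (S.noise σ τ).toReal

/-- `i` causes `j` in the digraph `D`: some arc of `D` leaves a state at which `i` is addressed and
`j` is absent, and enters a state at which `j` is present. -/
def Causes (S : NoisyControl m Ω A) (D : Ω → Ω → Prop) (i j : Fin m) : Prop :=
  ∃ σ τ, D σ τ ∧ S.Addresses σ i ∧ σ ∉ S.flaw j ∧ τ ∈ S.flaw j

open Classical in
/-- The neighborhood `Γ(f_i)` in the causality digraph of `D`; it contains `i` itself. -/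
noncomputable def neighborhood (S : NoisyControl m Ω A) (D : Ω → Ω → Prop) (i : Fin m) :
    Finset (Fin m) :=
  Finset.univ.filter fun j => j = i ∨ S.Causes D i j

/-- `max_τ |{σ ∈ f_i : τ ∈ supp κ(σ,·)}|`. -/
noncomputable def congestion [Fintype Ω] (S : NoisyControl m Ω A) (κ : Ω → PMF Ω) (i : Fin m) :
    ℕ :=
  Finset.univ.sup fun τ => Set.ncard {σ | σ ∈ S.flaw i ∧ τ ∈ (κ σ).support}

/-- `b_pr^{f_i}`. -/
noncomputable def bPr [Fintype Ω] (S : NoisyControl m Ω A) (i : Fin m) : ℝ :=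
  Real.logb 2 (S.congestion S.principal i)

/-- `b_ns`, the maximum over all flaws of `b_ns^{f_i}`. -/
noncomputable def bNs [Fintype Ω] (S : NoisyControl m Ω A) : ℝ :=
  ⨆ i : Fin m, Real.logb 2 (S.congestion S.noise i)

/-- Base-2 entropy of the transition distribution at `σ`. -/
noncomputable def stepEntropy [Fintype Ω] (S : NoisyControl m Ω A) (σ : Ω) : ℝ :=
  -∑ τ, S.trans σ τ * Real.logb 2 (S.trans σ τ)

/-- The least entropy of a step taken from a state at which `i` is addressed. (A junk value if
there is no such state; see `weight`.) -/
noncomputable def potential [Fintype Ω] (S : NoisyControl m Ω A) (i : Fin m) : ℝ :=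
  ⨅ σ : {σ // S.Addresses σ i}, S.stepEntropy σ.1

/-- Potential discounted by principal congestion. -/
noncomputable def amenability [Fintype Ω] (S : NoisyControl m Ω A) (i : Fin m) : ℝ :=
  S.potential i - S.bPr i

/-- `q_i(p) = p (Δ_i (b_ns + 5/2 + h(p)) - 2 - h(p))`, where `Δ_i = |Γ_ns(f_i)|`. -/
noncomputable def noiseLoss [Fintype Ω] (S : NoisyControl m Ω A) (i : Fin m) : ℝ :=
  S.p * (((S.neighborhood S.noiseArc i).card : ℝ) * (S.bNs + 5 / 2 + binEntropyTwo S.p)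
    - 2 - binEntropyTwo S.p)

open Classical in
/-- The summand `2^(-Amenability(f_j) + q_j(p))`. A flaw that is addressed at no state has potential
`min ∅ = +∞`, so its summand is `0`. -/
noncomputable def weight [Fintype Ω] (S : NoisyControl m Ω A) (j : Fin m) : ℝ :=
  if ∃ σ, S.Addresses σ j then (2 : ℝ) ^ (-S.amenability j + S.noiseLoss j) else 0

/-- Probability that the `t`-trajectory `x 0, …, x t` occurs, when the initial state has
distribution `θ`. -/
noncomputable def trajProb (S : NoisyControl m Ω A) (θ : PMF Ω) (t : ℕ) (x : Fin (t + 1) → Ω) : ℝ :=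
  (θ (x 0)).toReal * ∏ k : Fin t, S.trans (x k.castSucc) (x k.succ)

open Classical in
/-- Probability that no flawless state is reached within `t` steps, i.e. that all the states of the
`t`-trajectory are flawed. -/
noncomputable def probNotReached [Fintype Ω] (S : NoisyControl m Ω A) (θ : PMF Ω) (t : ℕ) : ℝ :=
  ∑ x : Fin (t + 1) → Ω, if ∀ k, ¬ S.Flawless (x k) then S.trajProb θ t x else 0

end NoisyControl

/-! Entropic form of the local lemma. Label every step as principal or noise, and let a step of kind
`b` addressing flaw `i` have weight `v b i`. If the expected logarithm of weight over probability is
at least `δ` in every flawed step, Gibbs' inequality bounds `δ` times the expected number of steps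
by the logarithm of the total weight of all paths (`expectedSteps_le_log`).

The total weight is bounded by decoding paths backwards. Sort the paths by the set `E` of initial
flaws that stay present until they are addressed. The highest-priority element of `E` is the flaw
addressed first, so a predecessor of a given state is one of at most `C b i` states, and the next
survivor set differs from `E` only by flaws in `Γ b i`. The local lemma condition then closes an
induction giving `|Ω| ∏ j ∈ E, ψ j` (`sum_rootedWeight_le`); summing over `E` gives at most `|Ω|
2^m` when each `ψ j ≤ 1`.

Here `ψ j = 2^(2+h) * weight j`, so the hypothesis makes its sum over each principal neighborhood at
most 1. The entropy of a step pays for congestion and for newly introduced flaws: `h` pays for the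
labels, and of the 2 bits 3/2 pay for principal introductions. Each step thus gains half a bit, and
the expected number of steps is at most `2 (log₂ |Ω| + m)`. Markov's inequality and restarts give
the exponential tail. -/

section PathWeights

/-! ### Path weights and Gibbs' inequality -/

variable {Ω ι β : Type*} [Fintype Ω] [DecidableEq ι] [Fintype β]

/-- Total weight of the paths from a state, stopped after `n` steps or at the first state without
flaws, where a step of kind `b` from a state with addressed flaw `i` has weight `v b i`. -/
noncomputable def pathWeight (U : Ω → Finset ι) (w : Ω → ι) (v : β → ι → ℝ)
    (K : Ω → β → Ω → ℝ) : ℕ → Ω → ℝ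
  | 0, _ => 1
  | n + 1, σ => if U σ = ∅ then 1 else
      ∑ b, ∑ τ, if 0 < K σ b τ then v b (w σ) * pathWeight U w v K n τ else 0

/-- Expected number of steps made before stopping at a state without flaws or after `n` steps. -/
noncomputable def expectedSteps (U : Ω → Finset ι) (K : Ω → β → Ω → ℝ) : ℕ → Ω → ℝ
  | 0, _ => 0
  | n + 1, σ => if U σ = ∅ then 0 else 1 + ∑ b, ∑ τ, K σ b τ * expectedSteps U K n τ

variable {U : Ω → Finset ι} {w : Ω → ι} {v : β → ι → ℝ} {K : Ω → β → Ω → ℝ}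

lemma pathWeight_pos (hK0 : ∀ σ b τ, 0 ≤ K σ b τ) (hK : ∀ σ, ∑ b, ∑ τ, K σ b τ = 1)
    (hv : ∀ b i, 0 ≤ v b i) (hvK : ∀ σ b τ, U σ ≠ ∅ → 0 < K σ b τ → 0 < v b (w σ))
    (n : ℕ) (σ : Ω) : 0 < pathWeight U w v K n σ := by
  induction n generalizing σ with
  | zero => simp [pathWeight]
  | succ n ih =>
    unfold pathWeight
    split_ifs with h
    · norm_num
    have hnn : ∀ b τ, 0 ≤ if 0 < K σ b τ then v b (w σ) * pathWeight U w v K n τ else 0 := by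
      intro b τ
      split_ifs
      · exact mul_nonneg (hv _ _) (ih τ).le
      · exact le_rfl
    obtain ⟨b, τ, hbτ⟩ : ∃ b τ, 0 < K σ b τ := by
      by_contra! hcon
      have := hK σ
      rw [Finset.sum_eq_zero fun b _ => Finset.sum_eq_zero fun τ _ =>
        le_antisymm (hcon b τ) (hK0 σ b τ)] at this
      exact zero_ne_one this
    refine Finset.sum_pos' (fun b _ => Finset.sum_nonneg fun τ _ => hnn b τ)
      ⟨b, Finset.mem_univ _, Finset.sum_pos' (fun τ _ => hnn b τ) ⟨τ, Finset.mem_univ _, ?_⟩⟩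
    rw [if_pos hbτ]
    exact mul_pos (hvK σ b τ h hbτ) (ih τ)

/-- If each step gains at least `δ` nats, then the expected number of steps is controlled by the
logarithm of the total weight of the paths. -/
theorem expectedSteps_le_log (hK0 : ∀ σ b τ, 0 ≤ K σ b τ) (hK : ∀ σ, ∑ b, ∑ τ, K σ b τ = 1)
    (hv : ∀ b i, 0 ≤ v b i) (hvK : ∀ σ b τ, U σ ≠ ∅ → 0 < K σ b τ → 0 < v b (w σ))
    {δ : ℝ} (hδ : ∀ σ, U σ ≠ ∅ → δ ≤ ∑ b, ∑ τ, K σ b τ * Real.log (v b (w σ) / K σ b τ))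
    (n : ℕ) (σ : Ω) : δ * expectedSteps U K n σ ≤ Real.log (pathWeight U w v K n σ) := by
  induction n generalizing σ with
  | zero => simp [pathWeight, expectedSteps]
  | succ n ih =>
    have hpos := pathWeight_pos hK0 hK hv hvK (n + 1) σ
    by_cases h : U σ = ∅
    · simp [pathWeight, expectedSteps, h]
    set Z := pathWeight U w v K (n + 1) σ with hZ
    have hZeq : Z = ∑ b, ∑ τ, if 0 < K σ b τ then v b (w σ) * pathWeight U w v K n τ else 0 := by
      rw [hZ, pathWeight, if_neg h]
    have hterm : ∀ b τ, K σ b τ * Real.log (v b (w σ) / K σ b τ) +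
        δ * (K σ b τ * expectedSteps U K n τ) ≤ K σ b τ * (Real.log Z - 1) +
        (if 0 < K σ b τ then v b (w σ) * pathWeight U w v K n τ else 0) / Z := by
      intro b τ
      split_ifs with hk
      · have hvp := hvK σ b τ h hk
        have hzp := pathWeight_pos hK0 hK hv hvK n τ
        -- Gibbs' inequality: the argument is the ratio of the weight-tilted transition probability,
        -- which sums to 1 over all steps, to the true one. Averaged over the true step, the
        -- right-hand side vanishes.
        have h1 := Real.log_le_sub_one_of_pos
          (show 0 < v b (w σ) / K σ b τ * pathWeight U w v K n τ / Z by positivity)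
        rw [Real.log_div (by positivity) (by positivity),
          Real.log_mul (by positivity) (by positivity)] at h1
        have h2 := mul_le_mul_of_nonneg_left h1 hk.le
        have h3 := mul_le_mul_of_nonneg_left (ih τ) hk.le
        have h4 : K σ b τ * (v b (w σ) / K σ b τ * pathWeight U w v K n τ / Z - 1) =
            v b (w σ) * pathWeight U w v K n τ / Z - K σ b τ := by
          field_simp
        rw [h4] at h2
        linarith
      · have : K σ b τ = 0 := le_antisymm (not_lt.1 hk) (hK0 _ _ _)
        simp [this]
    have hsum := Finset.sum_le_sum fun b (_ : b ∈ Finset.univ) =>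
      Finset.sum_le_sum fun τ (_ : τ ∈ Finset.univ) => hterm b τ
    simp only [Finset.sum_add_distrib, ← Finset.mul_sum, ← Finset.sum_mul, ← Finset.sum_div] at hsum
    rw [hK σ, ← hZeq, div_self hpos.ne'] at hsum
    rw [expectedSteps, if_neg h]
    have := hδ σ h
    linarith

/-! ### Survivor sets and the local lemma induction -/

variable [Fintype ι]

/-- The part of `pathWeight` due to the paths along which exactly the flaws in `E` survive from the
initial state until they are addressed. -/
noncomputable def rootedWeight (U : Ω → Finset ι) (w : Ω → ι) (v : β → ι → ℝ)
    (K : Ω → β → Ω → ℝ) : ℕ → Ω → Finset ι → ℝ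
  | 0, _, E => if E = ∅ then 1 else 0
  | n + 1, σ, E => if U σ = ∅ then (if E = ∅ then 1 else 0) else
      ∑ E', if insert (w σ) (E' ∩ U σ) = E then
        ∑ b, ∑ τ, if 0 < K σ b τ then v b (w σ) * rootedWeight U w v K n τ E' else 0 else 0

lemma rootedWeight_nonneg (hv : ∀ b i, 0 ≤ v b i) (n : ℕ) (σ : Ω) (E : Finset ι) :
    0 ≤ rootedWeight U w v K n σ E := by
  induction n generalizing σ E with
  | zero => unfold rootedWeight; split_ifs <;> norm_num
  | succ n ih =>
    unfold rootedWeight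
    split_ifs
    · norm_num
    · norm_num
    · refine Finset.sum_nonneg fun E' _ => ?_
      split_ifs
      · refine Finset.sum_nonneg fun b _ => Finset.sum_nonneg fun τ _ => ?_
        split_ifs
        · exact mul_nonneg (hv _ _) (ih _ _)
        · exact le_rfl
      · exact le_rfl

lemma rootedWeight_eq_zero (hw : ∀ σ, U σ ≠ ∅ → w σ ∈ U σ) (n : ℕ) (σ : Ω) (E : Finset ι)
    (hE : ¬ E ⊆ U σ) : rootedWeight U w v K n σ E = 0 := by
  have hne : E ≠ ∅ := by rintro rfl; simp at hE
  cases n with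
  | zero => simp [rootedWeight, hne]
  | succ n =>
    unfold rootedWeight
    split_ifs with h
    · rfl
    · refine Finset.sum_eq_zero fun E' _ => if_neg ?_
      rintro rfl
      exact hE (Finset.insert_subset (hw σ h) Finset.inter_subset_right)

/-- The survivor set at a state is a function of the one at the next state, so each path is counted
for exactly one `E`. -/
lemma sum_rootedWeight (n : ℕ) (σ : Ω) :
    ∑ E, rootedWeight U w v K n σ E = pathWeight U w v K n σ := by
  induction n generalizing σ with
  | zero => simp [rootedWeight, pathWeight]
  | succ n ih =>
    unfold rootedWeight pathWeight
    split_ifs with h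
    · simp
    · rw [Finset.sum_comm]
      simp only [Finset.sum_ite_eq, Finset.mem_univ, if_true]
      rw [Finset.sum_comm]
      refine Finset.sum_congr rfl fun b _ => ?_
      rw [Finset.sum_comm]
      refine Finset.sum_congr rfl fun τ _ => ?_
      split_ifs
      · rw [← Finset.mul_sum, ih]
      · simp

/-- Sets between `A` and `A ∪ G` are weighted at most like independent choices from `G`. -/
lemma sum_prod_between_le {ψ : ι → ℝ} (hψ : ∀ i, 0 ≤ ψ i) (A G : Finset ι) :
    ∑ E with A ⊆ E ∧ E ⊆ A ∪ G, ∏ j ∈ E, ψ j ≤ (∏ j ∈ A, ψ j) * ∏ j ∈ G, (1 + ψ j) := by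
  -- The map `E ↦ E \ A` is injective on these sets and lands in the subsets of `G`.
  rw [Finset.prod_one_add, Finset.mul_sum]
  calc ∑ E with A ⊆ E ∧ E ⊆ A ∪ G, ∏ j ∈ E, ψ j
      = ∑ E with A ⊆ E ∧ E ⊆ A ∪ G, (∏ j ∈ A, ψ j) * ∏ j ∈ E \ A, ψ j := by
        refine Finset.sum_congr rfl fun E hE => ?_
        rw [mul_comm, Finset.prod_sdiff (Finset.mem_filter.1 hE).2.1]
    _ = ∑ B ∈ (Finset.univ.filter fun E => A ⊆ E ∧ E ⊆ A ∪ G).image (· \ A),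
          (∏ j ∈ A, ψ j) * ∏ j ∈ B, ψ j := by
        rw [Finset.sum_image]
        intro E hE F hF h
        simp only [Finset.coe_filter, Finset.mem_univ, true_and, Set.mem_ofPred_eq] at hE hF
        rw [← Finset.sdiff_union_of_subset hE.1, ← Finset.sdiff_union_of_subset hF.1]
        exact congrArg (· ∪ A) h
    _ ≤ _ := by
        refine Finset.sum_le_sum_of_subset_of_nonneg ?_ fun B _ _ =>
          mul_nonneg (Finset.prod_nonneg fun _ _ => hψ _) (Finset.prod_nonneg fun _ _ => hψ _)
        intro B hB
        simp only [Finset.mem_image, Finset.mem_filter, Finset.mem_univ, true_and] at hB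
        obtain ⟨E, ⟨-, h⟩, rfl⟩ := hB
        rw [Finset.mem_powerset]
        intro j hj
        rw [Finset.mem_sdiff] at hj
        exact (Finset.mem_union.1 (h hj.1)).resolve_left hj.2

/-- If the weights `ψ` dominate the steps in the sense of the local lemma condition `hvψ`, then the
paths along which exactly the flaws in `E` survive have total weight at most `|Ω| ∏ j ∈ E, ψ j`. -/
theorem sum_rootedWeight_le {r : ι → ℕ} (hr : Function.Injective r)
    (hw : ∀ σ, U σ ≠ ∅ → w σ ∈ U σ) (hwr : ∀ σ, ∀ j ∈ U σ, r (w σ) ≤ r j)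
    (hv : ∀ b i, 0 ≤ v b i) {ψ : ι → ℝ} (hψ : ∀ i, 0 ≤ ψ i)
    {Γ : β → ι → Finset ι}
    (hΓ : ∀ σ b τ, U σ ≠ ∅ → 0 < K σ b τ → ∀ j ∈ U τ, (j = w σ ∨ j ∉ U σ) → j ∈ Γ b (w σ))
    {C : β → ι → ℕ} (hC : ∀ b i τ, Set.ncard {σ | i ∈ U σ ∧ 0 < K σ b τ} ≤ C b i)
    (hvψ : ∀ i, ∑ b, v b i * C b i * ∏ j ∈ Γ b i, (1 + ψ j) ≤ ψ i)
    (n : ℕ) (E : Finset ι) :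
    ∑ σ, rootedWeight U w v K n σ E ≤ Fintype.card Ω * ∏ j ∈ E, ψ j := by
  induction n generalizing E with
  | zero =>
    unfold rootedWeight
    split_ifs with h
    · simp [h]
    · simpa using mul_nonneg (Nat.cast_nonneg _) (Finset.prod_nonneg fun j _ => hψ j)
  | succ n ih =>
    rcases E.eq_empty_or_nonempty with rfl | hne
    · unfold rootedWeight
      calc _ ≤ ∑ _σ : Ω, (1 : ℝ) := by
            refine Finset.sum_le_sum fun σ _ => ?_
            simp only [Finset.insert_ne_empty, if_false, Finset.sum_const_zero, if_true]
            split_ifs <;> norm_num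
        _ = _ := by simp
    obtain ⟨i, hiE, hi⟩ := Finset.exists_min_image E r hne
    -- The addressed flaw lies in `E ⊆ U σ` and has least rank in `U σ`, so `E` alone determines it.
    have hsel : ∀ σ E', U σ ≠ ∅ → insert (w σ) (E' ∩ U σ) = E → w σ = i := by
      rintro σ E' hσ h
      have hsub : E ⊆ U σ := h ▸ Finset.insert_subset (hw σ hσ) Finset.inter_subset_right
      exact hr (le_antisymm (hwr σ i (hsub hiE)) (hi _ (h ▸ Finset.mem_insert_self _ _)))
    -- Other members of `E` survive into `E'`; whatever else is in `E'` was introduced by the step,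
    -- or is `i` itself occurring again.
    let S : β → Finset (Finset ι) := fun b =>
      Finset.univ.filter fun E' => E.erase i ⊆ E' ∧ E' ⊆ E.erase i ∪ Γ b i
    have hterm : ∀ σ, rootedWeight U w v K (n + 1) σ E ≤
        ∑ b, ∑ τ, ∑ E' ∈ S b, if i ∈ U σ ∧ 0 < K σ b τ then
          v b i * rootedWeight U w v K n τ E' else 0 := by
      intro σ
      have hnn : 0 ≤ ∑ b, ∑ τ, ∑ E' ∈ S b, if i ∈ U σ ∧ 0 < K σ b τ then
          v b i * rootedWeight U w v K n τ E' else 0 := by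
        refine Finset.sum_nonneg fun b _ => Finset.sum_nonneg fun τ _ =>
          Finset.sum_nonneg fun E' _ => ?_
        split_ifs
        · exact mul_nonneg (hv _ _) (rootedWeight_nonneg hv _ _ _)
        · exact le_rfl
      rw [rootedWeight]
      by_cases hσ : U σ = ∅
      · rwa [if_pos hσ, if_neg hne.ne_empty]
      rw [if_neg hσ]
      by_cases hwi : w σ = i
      swap
      · rwa [Finset.sum_eq_zero fun E' _ => if_neg fun h => hwi (hsel σ E' hσ h)]
      have hiU : i ∈ U σ := hwi ▸ hw σ hσ
      calc _ = ∑ E', ∑ b, ∑ τ, if insert (w σ) (E' ∩ U σ) = E ∧ 0 < K σ b τ then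
              v b i * rootedWeight U w v K n τ E' else 0 := by
            refine Finset.sum_congr rfl fun E' _ => ?_
            rw [hwi]
            split_ifs with h <;> simp [h]
        _ = ∑ b, ∑ τ, ∑ E', if insert (w σ) (E' ∩ U σ) = E ∧ 0 < K σ b τ then
              v b i * rootedWeight U w v K n τ E' else 0 := by
            rw [Finset.sum_comm]
            exact Finset.sum_congr rfl fun b _ => Finset.sum_comm
        _ ≤ _ := by
            refine Finset.sum_le_sum fun b _ => Finset.sum_le_sum fun τ _ => ?_
            rw [Finset.sum_filter]
            refine Finset.sum_le_sum fun E' _ => ?_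
            have h0 : 0 ≤ v b i * rootedWeight U w v K n τ E' :=
              mul_nonneg (hv _ _) (rootedWeight_nonneg hv _ _ _)
            split_ifs with h1 h2 h3 h3 h3
            · exact le_rfl
            · exact absurd ⟨hiU, h1.2⟩ h3
            -- A set `E'` outside `S b` has weight zero: were it contained in `U τ`, `hΓ` would
            -- place it in `S b`.
            · refine le_of_eq (mul_eq_zero_of_right _ (rootedWeight_eq_zero hw n τ E' ?_))
              intro hE'
              refine h2 ⟨?_, ?_⟩
              · intro j hj
                rw [Finset.mem_erase, ← h1.1, Finset.mem_insert, hwi] at hj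
                exact (Finset.mem_inter.1 (hj.2.resolve_left hj.1)).1
              · intro j hj
                rw [Finset.mem_union, or_iff_not_imp_left]
                intro hjE
                rw [← hwi]
                refine hΓ σ b τ hσ h1.2 j (hE' hj) ?_
                rw [or_iff_not_imp_left]
                intro hjw hjU
                refine hjE (Finset.mem_erase.2 ⟨hwi ▸ hjw, ?_⟩)
                rw [← h1.1]
                exact Finset.mem_insert_of_mem (Finset.mem_inter.2 ⟨hj, hjU⟩)
            all_goals first | exact h0 | exact le_rfl
    -- Congestion enters here: once `τ`, `b` and `i` are fixed, it limits the choice of the previous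
    -- state.
    have hcount : ∀ b τ, ∑ σ, (if i ∈ U σ ∧ 0 < K σ b τ then (1 : ℝ) else 0) ≤ C b i := by
      intro b τ
      rw [Finset.sum_boole]
      have := hC b i τ
      rw [Set.ncard_eq_toFinset_card'] at this
      refine le_trans (le_of_eq ?_) (Nat.cast_le.2 this)
      congr 2
      ext σ
      simp
    calc ∑ σ, rootedWeight U w v K (n + 1) σ E
        ≤ ∑ σ, ∑ b, ∑ τ, ∑ E' ∈ S b, if i ∈ U σ ∧ 0 < K σ b τ then
          v b i * rootedWeight U w v K n τ E' else 0 := Finset.sum_le_sum fun σ _ => hterm σ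
      _ = ∑ b, ∑ τ, ∑ E' ∈ S b, (∑ σ, if i ∈ U σ ∧ 0 < K σ b τ then (1 : ℝ) else 0) *
            (v b i * rootedWeight U w v K n τ E') := by
          rw [Finset.sum_comm]
          refine Finset.sum_congr rfl fun b _ => ?_
          rw [Finset.sum_comm]
          refine Finset.sum_congr rfl fun τ _ => ?_
          rw [Finset.sum_comm]
          refine Finset.sum_congr rfl fun E' _ => ?_
          rw [Finset.sum_mul]
          exact Finset.sum_congr rfl fun σ _ => by split_ifs <;> simp
      _ ≤ ∑ b, ∑ τ, ∑ E' ∈ S b, C b i * (v b i * rootedWeight U w v K n τ E') := by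
          refine Finset.sum_le_sum fun b _ => Finset.sum_le_sum fun τ _ =>
            Finset.sum_le_sum fun E' _ => mul_le_mul_of_nonneg_right (hcount b τ)
              (mul_nonneg (hv _ _) (rootedWeight_nonneg hv _ _ _))
      _ = ∑ b, v b i * C b i * ∑ E' ∈ S b, ∑ τ, rootedWeight U w v K n τ E' := by
          refine Finset.sum_congr rfl fun b _ => ?_
          rw [Finset.sum_comm, Finset.mul_sum]
          refine Finset.sum_congr rfl fun E' _ => ?_
          rw [Finset.mul_sum]
          exact Finset.sum_congr rfl fun τ _ => by ring
      _ ≤ ∑ b, v b i * C b i * (Fintype.card Ω *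
            ((∏ j ∈ E.erase i, ψ j) * ∏ j ∈ Γ b i, (1 + ψ j))) := by
          refine Finset.sum_le_sum fun b _ => mul_le_mul_of_nonneg_left ?_
            (mul_nonneg (hv _ _) (Nat.cast_nonneg _))
          calc _ ≤ ∑ E' ∈ S b, Fintype.card Ω * ∏ j ∈ E', ψ j :=
                Finset.sum_le_sum fun E' _ => ih E'
            _ ≤ _ := by
                rw [← Finset.mul_sum]
                exact mul_le_mul_of_nonneg_left (sum_prod_between_le hψ _ _) (Nat.cast_nonneg _)
      _ = Fintype.card Ω * (∏ j ∈ E.erase i, ψ j) *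
            ∑ b, v b i * C b i * ∏ j ∈ Γ b i, (1 + ψ j) := by
          rw [Finset.mul_sum]
          exact Finset.sum_congr rfl fun b _ => by ring
      _ ≤ Fintype.card Ω * (∏ j ∈ E.erase i, ψ j) * ψ i :=
          mul_le_mul_of_nonneg_left (hvψ i)
            (mul_nonneg (Nat.cast_nonneg _) (Finset.prod_nonneg fun j _ => hψ j))
      _ = _ := by rw [mul_assoc, Finset.prod_erase_mul E ψ hiE]

end PathWeights
-- Labelled steps and survival probabilities
namespace NoisyControl

variable {m : ℕ} {Ω : Type u} {A : Type v}

lemma sum_toReal_pmf [Fintype Ω] (μ : PMF Ω) : ∑ τ, (μ τ).toReal = 1 := by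
  rw [← ENNReal.toReal_sum fun τ _ => μ.apply_ne_top τ, ← tsum_fintype (L := .unconditional _),
    μ.tsum_coe, ENNReal.toReal_one]

lemma toReal_pmf_pos_iff {α : Type*} (μ : PMF α) (τ : α) :
    0 < (μ τ).toReal ↔ τ ∈ μ.support := by
  rw [PMF.mem_support_iff, ENNReal.toReal_pos_iff, pos_iff_ne_zero, lt_top_iff_ne_top]
  exact and_iff_left (μ.apply_ne_top τ)

/-- The probability that a step is of the given kind (`true` for noise). -/
noncomputable def kindProb (S : NoisyControl m Ω A) (b : Bool) : ℝ :=
  if b then S.p else 1 - S.p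

/-- The transition distribution of the steps of the given kind. -/
noncomputable def kindStep (S : NoisyControl m Ω A) (b : Bool) : Ω → PMF Ω :=
  if b then S.noise else S.principal

/-- The joint probability of the kind of a step and of the state that it leads to. -/
noncomputable def jointStep (S : NoisyControl m Ω A) (σ : Ω) (b : Bool) (τ : Ω) : ℝ :=
  S.kindProb b * (S.kindStep b σ τ).toReal

lemma kindProb_nonneg (S : NoisyControl m Ω A) (b : Bool) : 0 ≤ S.kindProb b := by
  cases b
  · simpa [kindProb] using S.p_le_one
  · simpa [kindProb] using S.p_nonneg

lemma jointStep_nonneg (S : NoisyControl m Ω A) (σ : Ω) (b : Bool) (τ : Ω) :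
    0 ≤ S.jointStep σ b τ :=
  mul_nonneg (S.kindProb_nonneg b) ENNReal.toReal_nonneg

lemma trans_eq_sum (S : NoisyControl m Ω A) (σ τ : Ω) :
    S.trans σ τ = ∑ b, S.jointStep σ b τ := by
  simp [trans, jointStep, kindProb, kindStep, add_comm]

lemma jointStep_pos (S : NoisyControl m Ω A) {σ τ : Ω} {b : Bool} (h : 0 < S.jointStep σ b τ) :
    0 < S.kindProb b ∧ τ ∈ (S.kindStep b σ).support := by
  refine ⟨pos_of_mul_pos_left h ENNReal.toReal_nonneg, ?_⟩
  rw [← toReal_pmf_pos_iff]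
  exact pos_of_mul_pos_right h (S.kindProb_nonneg b)

open Classical in
/-- The flaws present in a state, as a finite set. -/
noncomputable def present (S : NoisyControl m Ω A) (σ : Ω) : Finset (Fin m) :=
  Finset.univ.filter fun i => σ ∈ S.flaw i

lemma mem_present (S : NoisyControl m Ω A) {σ : Ω} {i : Fin m} :
    i ∈ S.present σ ↔ σ ∈ S.flaw i := by
  simp [present]

lemma present_eq_empty (S : NoisyControl m Ω A) {σ : Ω} : S.present σ = ∅ ↔ S.Flawless σ := by
  simp [Finset.eq_empty_iff_forall_notMem, mem_present, Flawless]

lemma exists_addresses (S : NoisyControl m Ω A) {σ : Ω} (h : ¬ S.Flawless σ) :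
    ∃ i, S.Addresses σ i := by
  rw [← present_eq_empty, ← Ne, ← Finset.nonempty_iff_ne_empty] at h
  obtain ⟨i, hi, hmin⟩ := Finset.exists_min_image _ S.rank h
  exact ⟨i, S.mem_present.1 hi, fun j hj => hmin j (S.mem_present.2 hj)⟩

lemma trans_nonneg (S : NoisyControl m Ω A) (σ τ : Ω) : 0 ≤ S.trans σ τ := by
  rw [trans_eq_sum]
  exact Finset.sum_nonneg fun b _ => S.jointStep_nonneg σ b τ

variable [Fintype Ω]

lemma sum_jointStep_kind (S : NoisyControl m Ω A) (σ : Ω) (b : Bool) :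
    ∑ τ, S.jointStep σ b τ = S.kindProb b := by
  simp only [jointStep]
  rw [← Finset.mul_sum, sum_toReal_pmf, mul_one]

lemma sum_jointStep (S : NoisyControl m Ω A) (σ : Ω) : ∑ b, ∑ τ, S.jointStep σ b τ = 1 := by
  simp [sum_jointStep_kind, kindProb]

lemma sum_trans (S : NoisyControl m Ω A) (σ : Ω) : ∑ τ, S.trans σ τ = 1 := by
  simp only [trans_eq_sum]
  rw [Finset.sum_comm, sum_jointStep]

open Classical in
/-- Probability that the first `n` steps from a state, and the state itself, are all flawed. -/
noncomputable def survival (S : NoisyControl m Ω A) : ℕ → Ω → ℝ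
  | 0, σ => if S.Flawless σ then 0 else 1
  | n + 1, σ => if S.Flawless σ then 0 else ∑ τ, S.trans σ τ * survival S n τ

lemma survival_nonneg (S : NoisyControl m Ω A) (n : ℕ) (σ : Ω) : 0 ≤ S.survival n σ := by
  induction n generalizing σ with
  | zero => unfold survival; split_ifs <;> norm_num
  | succ n ih =>
    unfold survival
    split_ifs
    · exact le_rfl
    · exact Finset.sum_nonneg fun τ _ => mul_nonneg (S.trans_nonneg σ τ) (ih τ)

/-- Markov property: after `a` flawed steps the chain restarts from some state, whence it survives
`b` more with probability at most `c`. -/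
lemma survival_add_le (S : NoisyControl m Ω A) {b : ℕ} {c : ℝ} (hc : ∀ σ, S.survival b σ ≤ c)
    (a : ℕ) (σ : Ω) : S.survival (a + b) σ ≤ c * S.survival a σ := by
  induction a generalizing σ with
  | zero =>
    rw [zero_add]
    by_cases h : S.Flawless σ
    · cases b <;> simp [survival, h]
    · simpa [survival, h] using hc σ
  | succ a ih =>
    rw [Nat.succ_add]
    unfold survival
    split_ifs with h
    · simp
    · rw [Finset.mul_sum]
      refine Finset.sum_le_sum fun τ _ => ?_
      calc _ ≤ S.trans σ τ * (c * S.survival a τ) :=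
            mul_le_mul_of_nonneg_left (ih τ) (S.trans_nonneg σ τ)
        _ = _ := by ring

lemma survival_le_one (S : NoisyControl m Ω A) (n : ℕ) (σ : Ω) : S.survival n σ ≤ 1 := by
  induction n generalizing σ with
  | zero => unfold survival; split_ifs <;> norm_num
  | succ n ih =>
    unfold survival
    split_ifs
    · norm_num
    · rw [← S.sum_trans σ]
      exact Finset.sum_le_sum fun τ _ => mul_le_of_le_one_right (S.trans_nonneg σ τ) (ih τ)

lemma survival_mul_add_le (S : NoisyControl m Ω A) {T : ℕ} {c : ℝ} (hc0 : 0 ≤ c)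
    (hc : ∀ σ, S.survival T σ ≤ c) (k a : ℕ) (σ : Ω) : S.survival (k * T + a) σ ≤ c ^ k := by
  induction k generalizing σ with
  | zero => simpa using S.survival_le_one a σ
  | succ k ih =>
    rw [show (k + 1) * T + a = T + (k * T + a) by ring, pow_succ]
    refine (S.survival_add_le ih T σ).trans (mul_le_mul_of_nonneg_left (hc σ) (by positivity))

/-- Markov's inequality: on survival all `n` steps are made. -/
lemma mul_survival_le_expectedSteps (S : NoisyControl m Ω A) (n : ℕ) (σ : Ω) :
    n * S.survival n σ ≤ expectedSteps S.present S.jointStep n σ := by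
  induction n generalizing σ with
  | zero => simp [expectedSteps]
  | succ n ih =>
    have h1 := S.survival_le_one (n + 1) σ
    by_cases h : S.Flawless σ
    · simp [survival, expectedSteps, S.present_eq_empty.2 h, h]
    · rw [expectedSteps, if_neg (mt S.present_eq_empty.1 h), Finset.sum_comm]
      have h2 : n * S.survival (n + 1) σ ≤
          ∑ τ, ∑ b, S.jointStep σ b τ * expectedSteps S.present S.jointStep n τ := by
        rw [survival, if_neg h, Finset.mul_sum]
        refine Finset.sum_le_sum fun τ _ => ?_
        rw [← Finset.sum_mul, ← trans_eq_sum]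
        calc _ = S.trans σ τ * (n * S.survival n τ) := by ring
          _ ≤ _ := mul_le_mul_of_nonneg_left (ih τ) (S.trans_nonneg σ τ)
      push_cast
      linarith

-- First-step analysis. The function `θ` is arbitrary so that the induction can absorb the first
-- transition into it.
open Classical in
lemma sum_trajectories (S : NoisyControl m Ω A) (t : ℕ) (θ : Ω → ℝ) :
    ∑ x : Fin (t + 1) → Ω, (if ∀ k, ¬ S.Flawless (x k) then
      θ (x 0) * ∏ k : Fin t, S.trans (x k.castSucc) (x k.succ) else 0) =
    ∑ σ, θ σ * S.survival t σ := by
  induction t generalizing θ with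
  | zero =>
    rw [← (Equiv.funUnique (Fin 1) Ω).symm.sum_comp]
    refine Finset.sum_congr rfl fun σ _ => ?_
    by_cases h : S.Flawless σ <;> simp [survival, h]
  | succ t ih =>
    rw [← (Fin.consEquiv fun _ => Ω).sum_comp, Fintype.sum_prod_type]
    refine Finset.sum_congr rfl fun σ _ => ?_
    rw [survival]
    by_cases h : S.Flawless σ
    · rw [if_pos h, mul_zero]
      exact Finset.sum_eq_zero fun y _ => if_neg fun hk => hk 0 (by simpa using h)
    · rw [if_neg h, ← ih, Finset.mul_sum]
      refine Finset.sum_congr rfl fun y _ => ?_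
      have h1 : (∀ k, ¬ S.Flawless ((Fin.consEquiv fun _ => Ω) (σ, y) k)) ↔
          ∀ k, ¬ S.Flawless (y k) := by
        rw [Fin.forall_fin_succ]
        simp [h]
      simp only [h1]
      split_ifs
      · rw [Fin.prod_univ_succ]
        simp
      · simp

lemma probNotReached_le (S : NoisyControl m Ω A) (θ : PMF Ω) {t : ℕ} {c : ℝ}
    (h : ∀ σ, S.survival t σ ≤ c) : S.probNotReached θ t ≤ c := by
  unfold probNotReached trajProb
  rw [S.sum_trajectories t fun σ => (θ σ).toReal]
  calc _ ≤ ∑ σ, (θ σ).toReal * c :=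
        Finset.sum_le_sum fun σ _ => mul_le_mul_of_nonneg_left (h σ) ENNReal.toReal_nonneg
    _ = c := by rw [← Finset.sum_mul, sum_toReal_pmf, one_mul]

end NoisyControl
-- Weights for the noisy chain and the entropy balance
namespace NoisyControl

variable {m : ℕ} {Ω : Type u} {A : Type v}

/-- The digraph of the steps of the given kind. -/
def kindArc (S : NoisyControl m Ω A) (b : Bool) : Ω → Ω → Prop :=
  if b then S.noiseArc else S.principalArc

lemma binEntropyTwo_nonneg {x : ℝ} (h0 : 0 ≤ x) (h1 : x ≤ 1) : 0 ≤ binEntropyTwo x := by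
  have h2 := mul_nonpos_of_nonneg_of_nonpos h0
    (Real.logb_nonpos (b := 2) (by norm_num) h0 h1)
  have h3 := mul_nonpos_of_nonneg_of_nonpos (sub_nonneg.2 h1)
    (Real.logb_nonpos (b := 2) (by norm_num) (sub_nonneg.2 h1) (by linarith))
  unfold binEntropyTwo
  linarith

lemma self_mem_neighborhood (S : NoisyControl m Ω A) (D : Ω → Ω → Prop) (i : Fin m) :
    i ∈ S.neighborhood D i := by
  simp [neighborhood]

lemma mem_neighborhood_of_jointStep (S : NoisyControl m Ω A) {σ τ : Ω} {b : Bool} {i j : Fin m}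
    (hi : S.Addresses σ i) (h : 0 < S.jointStep σ b τ) (hj : j ∈ S.present τ)
    (hij : j = i ∨ j ∉ S.present σ) : j ∈ S.neighborhood (S.kindArc b) i := by
  simp only [neighborhood, Finset.mem_filter, Finset.mem_univ, true_and]
  refine hij.imp_right fun hjσ => ⟨σ, τ, ?_, hi, mt S.mem_present.2 hjσ, S.mem_present.1 hj⟩
  have hsupp := (S.jointStep_pos h).2
  cases b
  · exact hsupp
  · exact S.noise_on_arcs σ τ hsupp

variable [Fintype Ω]

lemma weight_nonneg (S : NoisyControl m Ω A) (j : Fin m) : 0 ≤ S.weight j := by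
  unfold weight
  split_ifs <;> positivity

lemma one_le_congestion (S : NoisyControl m Ω A) (κ : Ω → PMF Ω) {i : Fin m} {σ : Ω}
    (h : σ ∈ S.flaw i) : 1 ≤ S.congestion κ i := by
  obtain ⟨τ, hτ⟩ := (κ σ).support_nonempty
  refine le_trans ?_ (Finset.le_sup (f := fun τ => Set.ncard {σ | σ ∈ S.flaw i ∧ τ ∈ (κ σ).support})
    (Finset.mem_univ τ))
  exact (Set.ncard_pos (Set.toFinite _)).2 ⟨σ, h, hτ⟩

/-- The weight that a surviving flaw contributes to the weight of a set of flaws. -/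
noncomputable def survivorWeight (S : NoisyControl m Ω A) (i : Fin m) : ℝ :=
  2 ^ (2 + binEntropyTwo S.p) * S.weight i

/-- Bound, in bits, on the logarithm of the number of ways to choose the flaws introduced by a step
of the given kind. -/
noncomputable def introductionBits (S : NoisyControl m Ω A) (b : Bool) (i : Fin m) : ℝ :=
  if b then ((S.neighborhood S.noiseArc i).card : ℝ) else 3 / 2

/-- The weight of a step of the given kind that addresses flaw `i`. -/
noncomputable def stepWeight (S : NoisyControl m Ω A) (b : Bool) (i : Fin m) : ℝ :=
  S.kindProb b * (S.survivorWeight i * 2 ^ (-S.introductionBits b i)) /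
    S.congestion (S.kindStep b) i

lemma survivorWeight_nonneg (S : NoisyControl m Ω A) (i : Fin m) : 0 ≤ S.survivorWeight i :=
  mul_nonneg (by positivity) (S.weight_nonneg i)

lemma stepWeight_nonneg (S : NoisyControl m Ω A) (b : Bool) (i : Fin m) :
    0 ≤ S.stepWeight b i :=
  div_nonneg (mul_nonneg (S.kindProb_nonneg b)
    (mul_nonneg (S.survivorWeight_nonneg i) (by positivity))) (Nat.cast_nonneg _)

lemma survivorWeight_le_one (S : NoisyControl m Ω A)
    (h : ∀ i, ∑ j ∈ S.neighborhood S.principalArc i, S.survivorWeight j ≤ 1) (i : Fin m) :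
    S.survivorWeight i ≤ 1 :=
  (Finset.single_le_sum (fun j _ => S.survivorWeight_nonneg j)
    (S.self_mem_neighborhood S.principalArc i)).trans (h i)

lemma prod_neighborhood_le (S : NoisyControl m Ω A)
    (h : ∀ i, ∑ j ∈ S.neighborhood S.principalArc i, S.survivorWeight j ≤ 1)
    (b : Bool) (i : Fin m) :
    ∏ j ∈ S.neighborhood (S.kindArc b) i, (1 + S.survivorWeight j) ≤
      2 ^ S.introductionBits b i := by
  cases b
  · calc ∏ j ∈ S.neighborhood S.principalArc i, (1 + S.survivorWeight j)
        ≤ ∏ j ∈ S.neighborhood S.principalArc i, Real.exp (S.survivorWeight j) := by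
          refine Finset.prod_le_prod (fun j _ => ?_) fun j _ => ?_
          · linarith [S.survivorWeight_nonneg j]
          · linarith [Real.add_one_le_exp (S.survivorWeight j)]
      _ = Real.exp (∑ j ∈ S.neighborhood S.principalArc i, S.survivorWeight j) :=
          (Real.exp_sum _ _).symm
      _ ≤ Real.exp 1 := Real.exp_le_exp.2 (h i)
      _ ≤ 2 ^ (3 / 2 : ℝ) := by
          -- Squaring reduces this to `e² ≤ 8`.
          refine (sq_le_sq₀ (Real.exp_pos 1).le (by positivity)).1 ?_
          rw [← Real.rpow_natCast (2 ^ (3 / 2 : ℝ)), ← Real.rpow_mul (by norm_num)]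
          have h1 := Real.exp_one_lt_d9
          have h2 := Real.exp_pos 1
          rw [show (3 / 2 : ℝ) * (2 : ℕ) = (3 : ℕ) by norm_num, Real.rpow_natCast]
          nlinarith
  · calc ∏ j ∈ S.neighborhood S.noiseArc i, (1 + S.survivorWeight j)
        ≤ ∏ _j ∈ S.neighborhood S.noiseArc i, (2 : ℝ) := by
          refine Finset.prod_le_prod (fun j _ => ?_) fun j _ => ?_
          · linarith [S.survivorWeight_nonneg j]
          · linarith [S.survivorWeight_le_one h j]
      _ = _ := by simp [introductionBits]

/-- The local lemma condition. The denominators of `stepWeight` cancel congestion and introductions,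
leaving the kind probabilities, which sum to 1. -/
lemma sum_stepWeight_le (S : NoisyControl m Ω A)
    (h : ∀ i, ∑ j ∈ S.neighborhood S.principalArc i, S.survivorWeight j ≤ 1) (i : Fin m) :
    ∑ b, S.stepWeight b i * S.congestion (S.kindStep b) i *
      ∏ j ∈ S.neighborhood (S.kindArc b) i, (1 + S.survivorWeight j) ≤ S.survivorWeight i := by
  calc _ ≤ ∑ b, S.kindProb b * S.survivorWeight i := by
        refine Finset.sum_le_sum fun b _ => ?_
        have hψ := S.survivorWeight_nonneg i
        have hk := S.kindProb_nonneg b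
        have h1 : S.stepWeight b i * S.congestion (S.kindStep b) i ≤
            S.kindProb b * (S.survivorWeight i * 2 ^ (-S.introductionBits b i)) := by
          -- Congestion is zero when the flaw is an empty set; division by zero is harmless since
          -- the left side vanishes.
          rcases eq_or_ne (S.congestion (S.kindStep b) i : ℝ) 0 with h0 | h0
          · rw [h0, mul_zero]
            positivity
          · exact (div_mul_cancel₀ _ h0).le
        calc _ ≤ S.kindProb b * (S.survivorWeight i * 2 ^ (-S.introductionBits b i)) *
                2 ^ S.introductionBits b i := by
              refine mul_le_mul h1 (S.prod_neighborhood_le h b i)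
                (Finset.prod_nonneg fun j _ => ?_) (by positivity)
              linarith [S.survivorWeight_nonneg j]
          _ = S.kindProb b * S.survivorWeight i *
                (2 ^ (-S.introductionBits b i) * 2 ^ S.introductionBits b i) := by ring
          _ = _ := by rw [← Real.rpow_add (by norm_num)]; simp
    _ = _ := by
        rw [← Finset.sum_mul]
        simp [kindProb]

lemma stepWeight_pos (S : NoisyControl m Ω A) {σ : Ω} {i : Fin m} (hi : S.Addresses σ i)
    {b : Bool} (hb : 0 < S.kindProb b) : 0 < S.stepWeight b i := by
  have hw : 0 < S.weight i := by
    rw [weight, if_pos ⟨σ, hi⟩]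
    positivity
  have hc : (0 : ℝ) < S.congestion (S.kindStep b) i :=
    Nat.cast_pos.2 (S.one_le_congestion _ hi.1)
  unfold stepWeight survivorWeight
  positivity

/-- Recording the kind of a step can only increase entropy, as each joint probability is at most the
total one. -/
lemma stepEntropy_le_joint (S : NoisyControl m Ω A) (σ : Ω) :
    S.stepEntropy σ ≤ -∑ b, ∑ τ, S.jointStep σ b τ * Real.logb 2 (S.jointStep σ b τ) := by
  rw [stepEntropy, Finset.sum_comm]
  refine neg_le_neg (Finset.sum_le_sum fun τ _ => ?_)
  have h : ∀ b, S.jointStep σ b τ * Real.logb 2 (S.jointStep σ b τ) ≤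
      S.jointStep σ b τ * Real.logb 2 (S.trans σ τ) := by
    intro b
    rcases (S.jointStep_nonneg σ b τ).eq_or_lt with h0 | h0
    · simp [← h0]
    · refine mul_le_mul_of_nonneg_left (Real.logb_le_logb_of_le (by norm_num) h0 ?_) h0.le
      rw [trans_eq_sum]
      exact Finset.single_le_sum (f := fun b => S.jointStep σ b τ)
        (fun b _ => S.jointStep_nonneg σ b τ) (Finset.mem_univ b)
  calc _ ≤ ∑ b, S.jointStep σ b τ * Real.logb 2 (S.trans σ τ) := Finset.sum_le_sum fun b _ => h b
    _ = _ := by rw [← Finset.sum_mul, ← trans_eq_sum]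

/-- The budget in bits. The average of `logb 2 (kindProb b)` is `-h`, cancelling the `h` in
`survivorWeight`; the principal bits leave `2 - 3/2 = 1/2`. All remaining terms carry a factor `p`
and are covered by `noiseLoss`. -/
lemma sum_kindProb_logb_stepWeight (S : NoisyControl m Ω A) {σ : Ω} {i : Fin m}
    (hi : S.Addresses σ i) :
    1 / 2 - S.potential i ≤ ∑ b, S.kindProb b * Real.logb 2 (S.stepWeight b i) := by
  have hkind : ∀ b, S.kindProb b * Real.logb 2 (S.stepWeight b i) =
      S.kindProb b * (Real.logb 2 (S.kindProb b) + (2 + binEntropyTwo S.p - S.amenability i +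
        S.noiseLoss i - S.introductionBits b i) -
        Real.logb 2 (S.congestion (S.kindStep b) i)) := by
    intro b
    rcases (S.kindProb_nonneg b).eq_or_lt with h0 | h0
    · simp [← h0]
    have hc : (S.congestion (S.kindStep b) i : ℝ) ≠ 0 :=
      Nat.cast_ne_zero.2 (Nat.one_le_iff_ne_zero.1 (S.one_le_congestion _ hi.1))
    have hψ : S.survivorWeight i * 2 ^ (-S.introductionBits b i) =
        2 ^ (2 + binEntropyTwo S.p - S.amenability i + S.noiseLoss i - S.introductionBits b i) := by
      rw [survivorWeight, weight, if_pos ⟨σ, hi⟩, ← Real.rpow_add (by norm_num),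
        ← Real.rpow_add (by norm_num)]
      congr 1
      ring
    rw [stepWeight, hψ, Real.logb_div (by positivity) hc, Real.logb_mul h0.ne' (by positivity),
      Real.logb_rpow (by norm_num) (by norm_num)]
  have hbns : Real.logb 2 (S.congestion S.noise i) ≤ S.bNs :=
    le_ciSup (f := fun i => Real.logb 2 (S.congestion S.noise i)) (Set.finite_range _).bddAbove i
  have hbns0 : 0 ≤ Real.logb 2 (S.congestion S.noise i) :=
    Real.logb_nonneg (by norm_num) (by exact_mod_cast S.one_le_congestion _ hi.1)
  have hbpr0 : 0 ≤ S.bPr i :=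
    Real.logb_nonneg (by norm_num) (by exact_mod_cast S.one_le_congestion _ hi.1)
  have hΔ : (1 : ℝ) ≤ (S.neighborhood S.noiseArc i).card :=
    Nat.one_le_cast.2 (Finset.card_pos.2 ⟨i, S.self_mem_neighborhood _ i⟩)
  have hh := binEntropyTwo_nonneg S.p_nonneg S.p_le_one
  have hp := S.p_nonneg
  simp only [hkind]
  simp only [Fintype.sum_bool, kindProb, kindStep, introductionBits, amenability, noiseLoss,
    if_true, Bool.false_eq_true, if_false]
  have hbPr : Real.logb 2 (S.congestion S.principal i) = S.bPr i := rfl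
  rw [hbPr]
  set Δ := ((S.neighborhood S.noiseArc i).card : ℝ)
  set d := Real.logb 2 (S.congestion S.noise i)
  have hhdef : binEntropyTwo S.p =
    -(S.p * Real.logb 2 S.p) - (1 - S.p) * Real.logb 2 (1 - S.p) := rfl
  set h := binEntropyTwo S.p
  -- As `Δ ≥ 1`, `Δ * bNs` covers `d`, `Δ * h` covers `h`, and `3/2 + (3/2) Δ ≥ 3` covers 2.
  have key : 0 ≤ S.p * (S.bPr i + 3 / 2 - Δ - d + Δ * (S.bNs + 5 / 2 + h) - 2 - h) := by
    refine mul_nonneg hp ?_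
    nlinarith [mul_nonneg (sub_nonneg.2 hΔ) (hbns0.trans hbns), mul_nonneg (sub_nonneg.2 hΔ) hh]
  linear_combination key - hhdef

lemma entropy_gain (S : NoisyControl m Ω A) {σ : Ω} {i : Fin m} (hi : S.Addresses σ i) :
    Real.log 2 / 2 ≤
      ∑ b, ∑ τ, S.jointStep σ b τ * Real.log (S.stepWeight b i / S.jointStep σ b τ) := by
  have hpot : S.potential i ≤ S.stepEntropy σ :=
    ciInf_le (f := fun σ : {σ // S.Addresses σ i} => S.stepEntropy σ.1)
      (Set.finite_range _).bddBelow ⟨σ, hi⟩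
  have h1 := S.stepEntropy_le_joint σ
  have h2 := S.sum_kindProb_logb_stepWeight hi
  have h3 : ∑ b, ∑ τ, S.jointStep σ b τ * Real.log (S.stepWeight b i / S.jointStep σ b τ) =
      Real.log 2 * (∑ b, S.kindProb b * Real.logb 2 (S.stepWeight b i) -
        ∑ b, ∑ τ, S.jointStep σ b τ * Real.logb 2 (S.jointStep σ b τ)) := by
    rw [← Finset.sum_sub_distrib, Finset.mul_sum]
    refine Finset.sum_congr rfl fun b _ => ?_
    rw [← S.sum_jointStep_kind σ b, Finset.sum_mul, ← Finset.sum_sub_distrib, Finset.mul_sum]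
    refine Finset.sum_congr rfl fun τ _ => ?_
    rcases (S.jointStep_nonneg σ b τ).eq_or_lt with h0 | h0
    · simp [← h0]
    · rw [Real.log_div (S.stepWeight_pos hi (S.jointStep_pos h0).1).ne' h0.ne', Real.logb,
        Real.logb]
      have := (Real.log_pos (by norm_num : (1 : ℝ) < 2)).ne'
      field_simp
  rw [h3, div_eq_mul_one_div]
  exact mul_le_mul_of_nonneg_left (by linarith) (Real.log_nonneg (by norm_num))

/-- The chain makes at most twice `log₂ |Ω| + m` flawed steps in expectation. -/
theorem expectedSteps_le (S : NoisyControl m Ω A)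
    (h : ∀ i, ∑ j ∈ S.neighborhood S.principalArc i, S.survivorWeight j ≤ 1)
    (hm : 0 < m) (n : ℕ) (σ : Ω) :
    expectedSteps S.present S.jointStep n σ ≤ 2 * (Real.logb 2 (Fintype.card Ω) + m) := by
  -- Flawless states receive a junk flaw, which exists because `m > 0`.
  have : ∀ σ, ∃ i, ¬ S.Flawless σ → S.Addresses σ i := by
    intro σ
    by_cases hσ : S.Flawless σ
    · exact ⟨⟨0, hm⟩, fun hσ' => absurd hσ hσ'⟩
    · exact (S.exists_addresses hσ).imp fun i hi _ => hi
  choose w hw using this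
  have hw' : ∀ σ, S.present σ ≠ ∅ → S.Addresses σ (w σ) :=
    fun σ hσ => hw σ (mt S.present_eq_empty.2 hσ)
  have hlog := expectedSteps_le_log (w := w) (v := S.stepWeight) S.jointStep_nonneg S.sum_jointStep
    S.stepWeight_nonneg (fun σ b τ hσ hk => S.stepWeight_pos (hw' σ hσ) (S.jointStep_pos hk).1)
    (fun σ hσ => S.entropy_gain (hw' σ hσ)) n σ
  have hpos := pathWeight_pos (w := w) (v := S.stepWeight) S.jointStep_nonneg S.sum_jointStep
    S.stepWeight_nonneg (fun σ b τ hσ hk => S.stepWeight_pos (hw' σ hσ) (S.jointStep_pos hk).1) n σ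
  have hcard : (0 : ℝ) < Fintype.card Ω := Nat.cast_pos.2 (Fintype.card_pos_iff.2 ⟨σ⟩)
  have hZ : pathWeight S.present w S.stepWeight S.jointStep n σ ≤ Fintype.card Ω * 2 ^ m := by
    rw [← sum_rootedWeight]
    calc ∑ E, rootedWeight S.present w S.stepWeight S.jointStep n σ E
        ≤ ∑ E, ∑ τ, rootedWeight S.present w S.stepWeight S.jointStep n τ E :=
          Finset.sum_le_sum fun E _ => Finset.single_le_sum
            (f := fun τ => rootedWeight S.present w S.stepWeight S.jointStep n τ E)
            (fun τ _ => rootedWeight_nonneg S.stepWeight_nonneg n τ E) (Finset.mem_univ σ)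
      _ ≤ ∑ E : Finset (Fin m), Fintype.card Ω * ∏ j ∈ E, S.survivorWeight j := by
          refine Finset.sum_le_sum fun E _ => sum_rootedWeight_le (r := fun i => (S.rank i : ℕ))
            (Γ := fun b => S.neighborhood (S.kindArc b))
            (C := fun b => S.congestion (S.kindStep b))
            (Fin.val_injective.comp S.rank.injective)
            (fun σ hσ => S.mem_present.2 (hw' σ hσ).1) ?_ S.stepWeight_nonneg
            S.survivorWeight_nonneg
            (fun σ b τ hσ hk j => S.mem_neighborhood_of_jointStep (hw' σ hσ) hk) ?_
            (S.sum_stepWeight_le h) n E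
          · intro σ j hj
            exact (hw' σ (Finset.ne_empty_of_mem hj)).2 j (S.mem_present.1 hj)
          · intro b i τ
            refine le_trans (Set.ncard_le_ncard ?_ (Set.toFinite _)) (Finset.le_sup
              (f := fun τ => Set.ncard {σ | σ ∈ S.flaw i ∧ τ ∈ (S.kindStep b σ).support})
              (Finset.mem_univ τ))
            exact fun σ hσ => ⟨S.mem_present.1 hσ.1, (S.jointStep_pos hσ.2).2⟩
      _ = Fintype.card Ω * ∏ j, (1 + S.survivorWeight j) := by
          rw [← Finset.mul_sum, Finset.prod_one_add, Finset.powerset_univ]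
      _ ≤ Fintype.card Ω * ∏ _j : Fin m, (2 : ℝ) := by
          refine mul_le_mul_of_nonneg_left (Finset.prod_le_prod (fun j _ => ?_) fun j _ => ?_)
            hcard.le
          · linarith [S.survivorWeight_nonneg j]
          · linarith [S.survivorWeight_le_one h j]
      _ = _ := by simp
  have hlog2 := hlog.trans (Real.log_le_log hpos hZ)
  have h2 : 0 < Real.log 2 := Real.log_pos (by norm_num)
  rw [Real.log_mul hcard.ne' (by positivity), Real.log_pow] at hlog2
  have h3 : Real.log (Fintype.card Ω) = Real.log 2 * Real.logb 2 (Fintype.card Ω) := by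
    rw [Real.logb]
    field_simp
  rw [h3] at hlog2
  refine le_of_mul_le_mul_left ?_ h2
  linarith

end NoisyControl

/-! ### Exponential tail by restarting -/

theorem theorem1 (ε : ℝ) (hε : 0 < ε) :
    ∃ R : ℝ, 0 < R ∧
      ∀ (m : ℕ) (Ω : Type u) (A : Type v) [Fintype Ω] (S : NoisyControl m Ω A),
        (∀ i : Fin m,
          ∑ j ∈ S.neighborhood S.principalArc i, S.weight j
            ≤ (2 : ℝ) ^ (-(2 + NoisyControl.binEntropyTwo S.p)) - ε) →
        ∀ (θ : PMF Ω) (s : ℝ), 1 / 2 < s →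
          S.probNotReached θ ⌊R * s * (Real.logb 2 (Fintype.card Ω) + m)⌋₊ < Real.exp (-s) := by
  -- `28 = 4 * 7`: there are `⌈2s⌉ ≤ 4s` blocks (using `s > 1/2`) of length `⌈6M⌉ ≤ 7M` (using `M ≥
  -- 1`).
  refine ⟨28, by norm_num, fun m Ω A _ S hS θ s hs => ?_⟩
  rcases Nat.eq_zero_or_pos m with rfl | hm
  · refine (S.probNotReached_le θ (c := 0) fun σ => ?_).trans_lt (Real.exp_pos _)
    have hσ : S.Flawless σ := fun i => i.elim0
    cases ⌊28 * s * (Real.logb 2 (Fintype.card Ω) + (0 : ℕ))⌋₊ <;>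
      simp [NoisyControl.survival, hσ]
  have hsum : ∀ i, ∑ j ∈ S.neighborhood S.principalArc i, S.survivorWeight j ≤ 1 := by
    intro i
    calc ∑ j ∈ S.neighborhood S.principalArc i, S.survivorWeight j
        = 2 ^ (2 + NoisyControl.binEntropyTwo S.p) *
            ∑ j ∈ S.neighborhood S.principalArc i, S.weight j := (Finset.mul_sum _ _ _).symm
      _ ≤ 2 ^ (2 + NoisyControl.binEntropyTwo S.p) *
            2 ^ (-(2 + NoisyControl.binEntropyTwo S.p)) :=
          mul_le_mul_of_nonneg_left (by linarith [hS i]) (by positivity)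
      _ = 1 := by rw [← Real.rpow_add (by norm_num)]; simp
  have hcard : (1 : ℝ) ≤ Fintype.card Ω := by
    obtain ⟨σ, -⟩ := θ.support_nonempty
    exact Nat.one_le_cast.2 (Fintype.card_pos_iff.2 ⟨σ⟩)
  have hM : 1 ≤ Real.logb 2 (Fintype.card Ω) + m :=
    le_add_of_nonneg_of_le (Real.logb_nonneg (by norm_num) hcard) (Nat.one_le_cast.2 hm)
  set M := Real.logb 2 (Fintype.card Ω) + m with hMdef
  have hT := Nat.le_ceil (6 * M)
  have hT' := Nat.ceil_lt_add_one (by positivity : 0 ≤ 6 * M)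
  set T := ⌈6 * M⌉₊
  have hk := Nat.le_ceil (2 * s)
  have hk' := Nat.ceil_lt_add_one (by linarith : 0 ≤ 2 * s)
  set k := ⌈2 * s⌉₊
  -- At most `2M` expected steps against a block length of at least `6M` gives `1/3 < 1/e`.
  have hstep : ∀ σ, S.survival T σ ≤ Real.exp (-1) := by
    intro σ
    have h1 := (S.mul_survival_le_expectedSteps T σ).trans (S.expectedSteps_le hsum hm T σ)
    have h2 := mul_le_mul_of_nonneg_right hT (S.survival_nonneg T σ)
    have h3 : S.survival T σ ≤ 1 / 3 := by
      refine le_of_mul_le_mul_left ?_ (by positivity : 0 < 6 * M)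
      linarith
    refine h3.trans ?_
    rw [Real.exp_neg, ← one_div]
    exact one_div_le_one_div_of_le (Real.exp_pos 1) (by linarith [Real.exp_one_lt_d9])
  have hkT : k * T ≤ ⌊28 * s * M⌋₊ := by
    refine Nat.le_floor ?_
    push_cast
    calc (k : ℝ) * T ≤ (4 * s) * (7 * M) :=
          mul_le_mul (by linarith) (by linarith) (Nat.cast_nonneg _) (by linarith)
      _ = _ := by ring
  -- The `a` leftover steps cost nothing. The blocks give `exp (-k)` with `k ≥ 2s > s`, whence the
  -- strict inequality.
  obtain ⟨a, ha⟩ := Nat.exists_eq_add_of_le hkT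
  rw [ha]
  refine (S.probNotReached_le θ
    (S.survival_mul_add_le (Real.exp_pos _).le hstep k a)).trans_lt ?_
  rw [← Real.exp_nat_mul, Real.exp_lt_exp]
  linarith
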